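/- Let $\mathbb{R}^{2,1}$ be $\mathbb{R}^3$ with the product $\langle x,y\rangle=x^1y^1+x^2y^2-x^3y^3$ and let $\mathbb{H}^2=\{x:\langle x,x\rangle=-1,\ x^3>0\}$. Let $S\subset\mathbb{R}^{2,1}$ be a convex spacelike surface of class $C^2$ (it lies in the future of each of its tangent planes, and these are spacelike), with future unit normal field $N$, and suppose that its Gauss map $G:S\to\mathbb{H}^2$, $p\mapsto N(p)$, is a homeomorphism. Let $B(v)=\nabla_vN$ be the shape operator of $S$ and $$\|B^{-1}\|_{op}=\sup\{\|B^{-1}(v)\|/\|v\| : v\in TS,\ v\neq 0\}\in[0,+\infty],$$ the norms being those of the first fundamental form ($\|B^{-1}\|_{op}=+\infty$ if $B$ is singular at some point). Let $D(S)$ be the domain of dependence of $S$, that is, the intersection of the closed future half-spaces bounded by lightlike planes that contain $S$. Let $\mathcal{G}$ be the space of unoriented geodesics of $\mathbb{H}^2$. A measured geodesic lamination is a locally finite Borel measure on $\mathcal{G}$ whose support consists of pairwise disjoint geodesics. For $x_0,x\in\mathbb{H}^2$ let $\mathcal{G}[x_0,x]$ be the set of geodesics meeting the segment $[x_0,x]$,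 and for such a geodesic $l$ let $\boldsymbol\sigma(l)$ be the unit spacelike vector orthogonal to $l$ pointing in the direction from $x_0$ to $x$. Let $\mu$ be the measured geodesic lamination dual to $D(S)$: for some $x_0\in\mathbb{H}^2$ not on a leaf of positive weight and some $y_0\in\mathbb{R}^{2,1}$, for every $x\in\mathbb{H}^2$ the point $y(x)=y_0+\int_{\mathcal{G}[x_0,x]}\boldsymbol\sigma\,d\mu$ lies in $D(S)$ and $y(x)+x^\perp$ is a support plane of $D(S)$. Let $\|\mu\|_{Th}=\sup_I\mu(\{l\in\mathcal{G}: l\cap I\neq\emptyset\})\in[0,+\infty]$, where $I$ ranges over the geodesic segments of $\mathbb{H}^2$ of length at most $1$ transverse to the support of $\mu$. Then $$\|\mu\|_{Th}\leq 2\sqrt{2(1+\cosh 1)}\;\|B^{-1}\|_{op}.$$ -/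

import Mathlib

open MeasureTheory
open scoped ENNReal

noncomputable section

/-- The horizontal Euclidean plane. -/
abbrev Plane : Type := EuclideanSpace ℝ (Fin 2)

/-- The vector space underlying `ℝ^{2,1}`: a horizontal part and a vertical (time) coordinate. -/
abbrev Mink : Type := Plane × ℝ

/-- The Minkowski product `x¹y¹ + x²y² - x³y³`, as a bilinear form. -/
def mink : Mink →ₗ[ℝ] Mink →ₗ[ℝ] ℝ :=
  LinearMap.mk₂ ℝ (fun x y => inner ℝ x.1 y.1 - x.2 * y.2)
    (by intro x x' y; simp [inner_add_left]; ring)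
    (by intro c x y; simp [inner_smul_left]; ring)
    (by intro x y y'; simp [inner_add_right]; ring)
    (by intro c x y; simp [inner_smul_right]; ring)

theorem mink_apply (x y : Mink) : mink x y = inner ℝ x.1 y.1 - x.2 * y.2 := rfl

/-- The Minkowski norm `√⟨v, v⟩` (meaningful for spacelike `v`). -/
def minkNorm (v : Mink) : ℝ := Real.sqrt (mink v v)

/-- The hyperbolic plane: the future sheet of the unit hyperboloid. -/
def hyperbolicPlane : Set Mink := {x | mink x x = -1 ∧ 0 < x.2}

/-- The hyperbolic distance between two points of the hyperboloid. -/
def hypDist (x y : Mink) : ℝ := Real.arcosh (-(mink x y))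

/-- The geodesic segment of the hyperbolic plane joining `x` and `y`: the radial projection to the
hyperboloid of the straight segment from `x` to `y`. -/
def geodesicSegment (x y : Mink) : Set Mink :=
  {z | z ∈ hyperbolicPlane ∧ ∃ a b : ℝ, 0 ≤ a ∧ 0 ≤ b ∧ z = a • x + b • y}

/-! ### The space of unoriented geodesics -/

/-- De Sitter space; a point `v` is an oriented geodesic, namely `v^⊥ ∩ ℍ²`. -/
def deSitter : Set Mink := {v | mink v v = 1}

/-- Identification of `v` with `-v`, i.e. forgetting the orientation of a geodesic. -/
def geodesicSetoid : Setoid deSitter where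
  r v w := (v : Mink) = w ∨ (v : Mink) = -w
  iseqv :=
    { refl := fun _ => Or.inl rfl
      symm := by
        rintro v w (h | h)
        · exact Or.inl h.symm
        · exact Or.inr (by rw [h, neg_neg])
      trans := by
        rintro u v w (h | h) (h' | h')
        · exact Or.inl (h.trans h')
        · exact Or.inr (h.trans h')
        · exact Or.inr (by rw [h, h'])
        · exact Or.inl (by rw [h, h', neg_neg]) }

/-- The space of unoriented geodesics of the hyperbolic plane, with the quotient topology (an open
Möbius strip) and its Borel σ-algebra. -/
def Geodesic : Type := Quotient geodesicSetoid

instance : TopologicalSpace Geodesic :=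
  inferInstanceAs (TopologicalSpace (Quotient geodesicSetoid))

instance : MeasurableSpace Geodesic := borel Geodesic

instance : BorelSpace Geodesic := ⟨rfl⟩

namespace Geodesic

/-- The set of points of the hyperbolic plane on a geodesic. -/
def points (l : Geodesic) : Set Mink :=
  Quotient.lift (s := geodesicSetoid)
    (fun v : deSitter => {x : Mink | x ∈ hyperbolicPlane ∧ mink v x = 0})
    (by
      rintro v w (h | h)
      · simp only [h]
      · simp only [h, map_neg, LinearMap.neg_apply, neg_eq_zero]) l

/-- For a geodesic `l` crossing the oriented segment `[x₀, x]`, the unit spacelike vector orthogonal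
to `l` that points in the direction from `x₀` to `x`. (If the whole segment lies on `l` there is no
such direction and the value is `0`.) -/
def normal (x₀ x : Mink) (l : Geodesic) : Mink :=
  Quotient.lift (s := geodesicSetoid)
    (fun v : deSitter => Real.sign (mink v (x - x₀)) • (v : Mink))
    (by
      rintro v w (h | h)
      · simp only [h]
      · simp only [h, map_neg, LinearMap.neg_apply, Real.sign_neg, smul_neg, neg_smul,
          neg_neg]) l

/-- The set of geodesics that meet a given subset of the hyperbolic plane. -/
def meeting (I : Set Mink) : Set Geodesic := {l | (l.points ∩ I).Nonempty}

end Geodesic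

/-! ### Measured geodesic laminations -/

/-- A geodesic lamination: a closed set of pairwise disjoint geodesics. -/
def IsGeodesicLamination (L : Set Geodesic) : Prop :=
  IsClosed L ∧ ∀ l ∈ L, ∀ l' ∈ L, l ≠ l' → Disjoint l.points l'.points

/-- A measured geodesic lamination: a locally finite Borel measure on the space of geodesics whose
support is a geodesic lamination. -/
def IsMeasuredLamination (μ : Measure Geodesic) : Prop :=
  IsLocallyFiniteMeasure μ ∧ IsGeodesicLamination μ.support

/-- The segment `I` is transverse to the support of `μ`: no leaf meets it in more than a point. -/
def IsTransverse (μ : Measure Geodesic) (I : Set Mink) : Prop :=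
  ∀ l ∈ μ.support, (l.points ∩ I).Subsingleton

/-- The Thurston norm: the supremum of the masses of geodesic segments of length at most `1`
transverse to the support. It is `∞` exactly when the lamination is not bounded. -/
def thurstonNorm (μ : Measure Geodesic) : ℝ≥0∞ :=
  ⨆ (x ∈ hyperbolicPlane) (y ∈ hyperbolicPlane) (_ : hypDist x y ≤ 1)
    (_ : IsTransverse μ (geodesicSegment x y)), μ (Geodesic.meeting (geodesicSegment x y))

/-- The plane `y + x^⊥` is a support plane of `D`, touching `D` at `y`: the set `D` contains `y` and
lies in the closed future of the plane. -/
def IsSupportPlaneAt (D : Set Mink) (y x : Mink) : Prop :=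
  y ∈ D ∧ ∀ p ∈ D, mink p x ≤ mink y x

/-- The point `y(x) = y₀ + ∫_{𝒢[x₀,x]} σ dμ`, where `𝒢[x₀,x]` is the set of geodesics meeting
`[x₀,x]` and `σ` their unit normal pointing from `x₀` to `x`. -/
def laminationPoint (μ : Measure Geodesic) (x₀ y₀ x : Mink) : Mink :=
  y₀ + ∫ l in Geodesic.meeting (geodesicSegment x₀ x), Geodesic.normal x₀ x l ∂μ

/-- `μ` is the dual lamination of `D`. For some base point `x₀`, not on a leaf of positive weight,
and some `y₀`, the plane `y(x) + x^⊥` is for every `x` in the hyperbolic plane a support plane of `D`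
touching it at `y(x)`. (For `x = x₀` this says that `y₀ + x₀^⊥` is a support plane touching `D` at
`y₀`. A leaf of positive weight through `x₀` has to be excluded, since the formula for `y(x)` would
count its weight in full on both sides of the leaf.) -/
def IsDualLamination (μ : Measure Geodesic) (D : Set Mink) : Prop :=
  IsMeasuredLamination μ ∧
    ∃ x₀ ∈ hyperbolicPlane, (∀ l : Geodesic, x₀ ∈ l.points → μ {l} = 0) ∧
      ∃ y₀ : Mink, ∀ x ∈ hyperbolicPlane, IsSupportPlaneAt D (laminationPoint μ x₀ y₀ x) x

/-! ### Convex spacelike surfaces -/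

/-- A convex spacelike surface of class `C²`, i.e. one that lies in the future of each of its tangent
planes. Such a surface meets every vertical line at most once, hence it is the graph of a `C²`
function on an open subset of the horizontal plane, with gradient of norm less than `1`. The surface
is an entire graph when `base = univ`, but this is not required. -/
structure ConvexSpacelikeSurface where
  base : Set Plane
  height : Plane → ℝ
  isOpen_base : IsOpen base
  contDiffOn_height : ContDiffOn ℝ 2 height base
  spacelike : ∀ w ∈ base, ‖gradient height w‖ < 1
  convex : ∀ w ∈ base, ∀ w' ∈ base,
    height w + inner ℝ (gradient height w) (w' - w) ≤ height w'

namespace ConvexSpacelikeSurface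

variable (S : ConvexSpacelikeSurface)

/-- The surface as a subset of Minkowski space. -/
def carrier : Set Mink := {p | p.1 ∈ S.base ∧ p.2 = S.height p.1}

/-- The future unit normal at the point of the surface over `w`. -/
def unitNormal (w : Plane) : Mink :=
  (Real.sqrt (1 - ‖gradient S.height w‖ ^ 2))⁻¹ • (gradient S.height w, (1 : ℝ))

theorem one_sub_sq_pos {w : Plane} (hw : w ∈ S.base) : 0 < 1 - ‖gradient S.height w‖ ^ 2 := by
  have h := S.spacelike w hw
  have h0 := norm_nonneg (gradient S.height w)
  nlinarith

theorem unitNormal_mem {w : Plane} (hw : w ∈ S.base) : S.unitNormal w ∈ hyperbolicPlane := by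
  have h := S.one_sub_sq_pos hw
  have hs := Real.sqrt_pos.2 h
  have hsq := Real.sq_sqrt h.le
  refine ⟨?_, ?_⟩
  · simp only [unitNormal, map_smul, LinearMap.smul_apply, mink_apply, smul_eq_mul,
      real_inner_self_eq_norm_sq]
    field_simp
    rw [hsq]
    ring
  · simp only [unitNormal, Prod.smul_mk, smul_eq_mul, mul_one]
    exact inv_pos.2 hs

theorem differentiableAt_unitNormal {w : Plane} (hw : w ∈ S.base) :
    DifferentiableAt ℝ S.unitNormal w := by
  have hf : ContDiffAt ℝ 2 S.height w :=
    S.contDiffOn_height.contDiffAt (S.isOpen_base.mem_nhds hw)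
  have h1 : DifferentiableAt ℝ (fderiv ℝ S.height) w :=
    (hf.fderiv_right (m := 1) (by norm_num)).differentiableAt (by norm_num)
  have hg : DifferentiableAt ℝ (gradient S.height) w :=
    ((InnerProductSpace.toDual ℝ Plane).symm.toContinuousLinearEquiv.toContinuousLinearMap
      |>.differentiableAt).comp w h1
  have h := S.one_sub_sq_pos hw
  have hn : DifferentiableAt ℝ (fun w => 1 - ‖gradient S.height w‖ ^ 2) w :=
    (differentiableAt_const _).sub (hg.norm_sq ℝ)
  have hs : DifferentiableAt ℝ (fun w => (Real.sqrt (1 - ‖gradient S.height w‖ ^ 2))⁻¹) w :=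
    (hn.sqrt h.ne').inv (Real.sqrt_pos.2 h).ne'
  exact hs.smul (hg.prodMk (differentiableAt_const _))

/-- The derivative of the unit normal is tangent to the surface. -/
theorem mink_fderiv_unitNormal {w : Plane} (hw : w ∈ S.base) (a : Plane) :
    mink (fderiv ℝ S.unitNormal w a) (S.unitNormal w) = 0 := by
  have hd := (S.differentiableAt_unitNormal hw).hasFDerivAt
  have h1 := hd.fst
  have h2 := hd.snd
  have h3 := (h1.inner ℝ h1).sub (h2.mul h2)
  have hc : (fun v => inner ℝ (S.unitNormal v).1 (S.unitNormal v).1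
      - (S.unitNormal v).2 * (S.unitNormal v).2) =ᶠ[nhds w] fun _ => (-1 : ℝ) := by
    filter_upwards [S.isOpen_base.mem_nhds hw] with v hv
    exact (S.unitNormal_mem hv).1
  have h4 := (h3.congr_of_eventuallyEq hc.symm).unique (hasFDerivAt_const (-1 : ℝ) w)
  have h5 := congrArg (fun L : Plane →L[ℝ] ℝ => L a) h4
  simp [fderivInnerCLM_apply] at h5
  rw [mink_apply]
  rw [real_inner_comm] at h5
  linarith [real_inner_comm (S.unitNormal w).1 (fderiv ℝ S.unitNormal w a).1]

/-- The Gauss map, with values in the hyperbolic plane. -/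
def gaussMap (p : S.carrier) : hyperbolicPlane :=
  ⟨S.unitNormal p.1.1, S.unitNormal_mem p.2.1⟩

/-- The tangent plane at `p`, the Minkowski-orthogonal complement of the normal. -/
def tangentPlane (p : S.carrier) : Submodule ℝ Mink where
  carrier := {v | mink v (S.unitNormal p.1.1) = 0}
  add_mem' := by intro v w hv hw; simp_all
  zero_mem' := by simp
  smul_mem' := by intro c v hv; simp_all

/-- The shape operator `B(v) = ∇_v N`: the derivative of the unit normal field `N` along the
surface in the direction of the tangent vector `v`, whose horizontal part is `v.1`. -/
def shapeOperator (p : S.carrier) : Module.End ℝ (S.tangentPlane p) where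
  toFun v := ⟨fderiv ℝ S.unitNormal p.1.1 v.1.1, S.mink_fderiv_unitNormal p.2.1 v.1.1⟩
  map_add' := by intro v w; ext1; simp
  map_smul' := by intro c v; ext1; simp

open Classical in
/-- The operator norm `sup {‖B⁻¹ v‖ / ‖v‖ : v ∈ TS, v ≠ 0}` of the inverse shape operator, for the
first fundamental form; it is `∞` if `B` is not invertible at some point. -/
def invShapeNorm : ℝ≥0∞ :=
  ⨆ p : S.carrier, if IsUnit (S.shapeOperator p) then
      ⨆ (v : S.tangentPlane p) (_ : v ≠ 0),
        ENNReal.ofReal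
          (minkNorm (Ring.inverse (S.shapeOperator p) v : S.tangentPlane p) / minkNorm v)
    else ∞

/-- The domain of dependence: the intersection of the closed future half-spaces that contain the
surface and are bounded by lightlike planes. The lightlike plane `{q | ⟨q, n⟩ = c}`, with `n`
lightlike and future-directed, bounds the future half-space `{q | ⟨q, n⟩ ≤ c}`. -/
def domainOfDependence : Set Mink :=
  {p | ∀ (n : Mink) (c : ℝ), mink n n = 0 → 0 < n.2 → (∀ q ∈ S.carrier, mink q n ≤ c) →
    mink p n ≤ c}

end ConvexSpacelikeSurface

end

/-! ### The Minkowski product -/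

/-! Write `C` for `‖B⁻¹‖` and assume it finite. Parametrize `S` by its normal and follow the support
function along a unit speed geodesic `X` of the hyperbolic plane from `z`. Its second derivative
minus itself is `⟨B⁻¹X', X'⟩ ≤ C`, so it stays below the support function of the hyperboloid of
radius `C` tangent to `S` at the point `p` with normal `z` (`mink_hypGeodesic_le`). Letting the
geodesic go to infinity gives `⟨q - p, z + w⟩ ≤ C` for each lightlike `z + w`, first for `q ∈ S` and
then for `q ∈ D(S)`: the domain lies in the future of `p - Cz`.

Let `y`, `y'` be points where support planes with normals `x`, `x'` touch `D(S)`, and take `z` to be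
the midpoint of `[x, x']`. The lightlike bounds at `p`, together with the two support planes, give
`|y' - y| ≤ 4C` when `cosh d(x, x') ≤ 5/3` (`mink_sub_self_le`).

Conversely, `y' - y` is the integral of the oriented unit normals of the leaves crossing `[x, x']`.
Normals of disjoint leaves, oriented alike, have product at least `1`, so `⟨y' - y, y' - y⟩` is at
least the squared mass of the leaves strictly separating `x` from `x'`
(`IsMeasuredLamination.sq_measure_le`).

Since `cosh 1 < 5/3`, there is room to prolong a segment of length at most `1` and so to include
leaves through its end points. The result is the bound `4C`, and `4 ≤ 2√(2(1 + cosh 1))`. -/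

theorem mink_comm (x y : Mink) : mink x y = mink y x := by
  rw [mink_apply, mink_apply, real_inner_comm, mul_comm]

theorem mink_self (x : Mink) : mink x x = ‖x.1‖ ^ 2 - x.2 ^ 2 := by
  rw [mink_apply, real_inner_self_eq_norm_sq, sq x.2]

theorem mink_coord (x y : Mink) :
    mink x y = x.1 0 * y.1 0 + x.1 1 * y.1 1 - x.2 * y.2 := by
  rw [mink_apply, PiLp.inner_apply, Fin.sum_univ_two]
  simp [mul_comm]

theorem norm_fst_lt_of_mem_hyperbolicPlane {x : Mink} (hx : x ∈ hyperbolicPlane) :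
    ‖x.1‖ < x.2 := by
  have h := hx.1
  rw [mink_self] at h
  exact lt_of_pow_lt_pow_left₀ 2 hx.2.le (by linarith)

theorem mink_le_neg_one {x y : Mink} (hx : x ∈ hyperbolicPlane) (hy : y ∈ hyperbolicPlane) :
    mink x y ≤ -1 := by
  have h1 := hx.1
  have h2 := hy.1
  rw [mink_self] at h1 h2
  have h3 := real_inner_le_norm x.1 y.1
  have h4 := mul_pos hx.2 hy.2
  -- With `X = x.2` and `Y = y.2`, the squared inequality `(X² - 1)(Y² - 1) ≤ (XY - 1)²` is `(X -
  -- Y)² ≥ 0`.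
  have h5 : ‖x.1‖ * ‖y.1‖ ≤ x.2 * y.2 - 1 := by
    refine le_of_sq_le_sq ?_ ?_
    · have : (‖x.1‖ * ‖y.1‖) ^ 2 = (x.2 ^ 2 - 1) * (y.2 ^ 2 - 1) := by
        rw [mul_pow]; congr 1 <;> linarith
      rw [this]
      nlinarith [sq_nonneg (x.2 - y.2)]
    · have hx1 : 1 ≤ x.2 := by nlinarith [sq_nonneg ‖x.1‖, hx.2]
      have hy1 : 1 ≤ y.2 := by nlinarith [sq_nonneg ‖y.1‖, hy.2]
      nlinarith
  rw [mink_apply]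
  linarith

theorem mink_neg_of_causal {n x : Mink} (hn : mink n n ≤ 0) (hn0 : 0 < n.2)
    (hx : x ∈ hyperbolicPlane) : mink n x < 0 := by
  rw [mink_self] at hn
  have h1 : ‖n.1‖ ≤ n.2 := le_of_sq_le_sq (by linarith) hn0.le
  have h2 := norm_fst_lt_of_mem_hyperbolicPlane hx
  have h3 := real_inner_le_norm n.1 x.1
  rw [mink_apply]
  nlinarith [norm_nonneg x.1]

theorem snd_pos_of_causal {n x : Mink} (hn : mink n n ≤ 0) (hx : x ∈ hyperbolicPlane)
    (hnx : mink n x < 0) : 0 < n.2 := by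
  by_contra! h
  rcases h.eq_or_lt with h | h
  · have h0 : n.1 = 0 := by
      rw [mink_self, h] at hn
      have : ‖n.1‖ ^ 2 = 0 := le_antisymm (by linarith) (sq_nonneg _)
      simpa using this
    rw [mink_apply, h, h0] at hnx
    simp at hnx
  · have := mink_neg_of_causal (n := -n) (by simpa using hn) (by simpa using h) hx
    simp only [map_neg, LinearMap.neg_apply] at this
    linarith

theorem smul_mem_hyperbolicPlane {n : Mink} (hn : mink n n < 0) (hn0 : 0 < n.2) :
    (Real.sqrt (-(mink n n)))⁻¹ • n ∈ hyperbolicPlane := by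
  have hs : 0 < Real.sqrt (-(mink n n)) := Real.sqrt_pos.2 (by linarith)
  have hsq := Real.sq_sqrt (show 0 ≤ -(mink n n) by linarith)
  refine ⟨?_, ?_⟩
  · simp only [map_smul, LinearMap.smul_apply, smul_eq_mul]
    field_simp
    linarith
  · simp only [Prod.smul_snd, smul_eq_mul]
    positivity

/-- A timelike vector, or its opposite, is future-directed, and then its product with `z` is
strictly negative. -/
theorem mink_self_nonneg_of_orthogonal {u z : Mink} (hz : z ∈ hyperbolicPlane)
    (hu : mink u z = 0) : 0 ≤ mink u u := by
  by_contra! h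
  rcases lt_trichotomy u.2 0 with h0 | h0 | h0
  · have := mink_neg_of_causal (n := -u) (by simpa using h.le) (by simpa using h0) hz
    simp [hu] at this
  · rw [mink_self, h0] at h
    nlinarith [sq_nonneg ‖u.1‖]
  · exact (mink_neg_of_causal h.le h0 hz).ne hu

/-- Cauchy-Schwarz in the spacelike plane orthogonal to a point of the hyperboloid. -/
theorem mink_sq_le_of_orthogonal {u v z : Mink} (hz : z ∈ hyperbolicPlane)
    (hu : mink u z = 0) (hv : mink v z = 0) :
    mink u v ^ 2 ≤ mink u u * mink v v := by
  have h : ∀ t : ℝ, 0 ≤ mink v v * (t * t) + 2 * mink u v * t + mink u u := by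
    intro t
    have h1 := mink_self_nonneg_of_orthogonal (u := u + t • v) hz (by simp [hu, hv])
    simp only [map_add, map_smul, LinearMap.add_apply, LinearMap.smul_apply, smul_eq_mul] at h1
    rw [mink_comm v u] at h1
    linarith
  have := discrim_le_zero h
  rw [discrim] at this
  linarith

theorem mink_le_minkNorm_mul {u v z : Mink} (hz : z ∈ hyperbolicPlane)
    (hu : mink u z = 0) (hv : mink v z = 0) : mink u v ≤ minkNorm u * minkNorm v := by
  rw [minkNorm, minkNorm, ← Real.sqrt_mul (mink_self_nonneg_of_orthogonal hz hu)]
  exact Real.le_sqrt_of_sq_le (mink_sq_le_of_orthogonal hz hu hv)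

/-- Two unit spacelike vectors whose orthogonal geodesics are disjoint span a plane that is not
spacelike. -/
theorem one_le_abs_mink_of_disjoint {v w : Mink} (hv : mink v v = 1) (hw : mink w w = 1)
    (h : ∀ x ∈ hyperbolicPlane, mink v x = 0 → mink w x ≠ 0) : 1 ≤ |mink v w| := by
  by_contra! hlt
  have hsq : mink v w ^ 2 < 1 := by
    rw [← sq_abs]; nlinarith [abs_nonneg (mink v w)]
  -- The Lorentzian cross product of `v` and `w`. Its square is `⟨v, w⟩² - 1 < 0`, so `±n`
  -- normalizes to a common point of the two geodesics.
  let n : Mink := (!₂[v.1 1 * w.2 - v.2 * w.1 1, v.2 * w.1 0 - v.1 0 * w.2],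
    -(v.1 0 * w.1 1 - v.1 1 * w.1 0))
  have hvn : mink v n = 0 := by rw [mink_coord]; simp [n]; ring
  have hwn : mink w n = 0 := by rw [mink_coord]; simp [n]; ring
  have hnn : mink n n < 0 := by
    have : mink n n = mink v w ^ 2 - mink v v * mink w w := by
      simp only [mink_coord]; simp [n]; ring
    rw [this, hv, hw]; linarith
  have key : ∀ m : Mink, mink m m < 0 → mink v m = 0 → mink w m = 0 → ¬ 0 < m.2 := by
    intro m hm h1 h2 h0
    exact h _ (smul_mem_hyperbolicPlane hm h0) (by simp [h1]) (by simp [h2])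
  rcases lt_trichotomy n.2 0 with h0 | h0 | h0
  · exact key (-n) (by simpa using hnn) (by simp [hvn]) (by simp [hwn]) (by simpa using h0)
  · rw [mink_self, h0] at hnn
    nlinarith [sq_nonneg ‖n.1‖]
  · exact key n hnn hvn hwn h0

/-- Unit normals of disjoint geodesics crossing a segment, both oriented along the segment. -/
theorem one_le_mink_of_crossing {v w x y : Mink} (hx : x ∈ hyperbolicPlane)
    (hy : y ∈ hyperbolicPlane) (hv : mink v v = 1) (hw : mink w w = 1)
    (h : 1 ≤ |mink v w|) (hvx : mink v x ≤ 0) (hvy : 0 ≤ mink v y) (hv0 : 0 < mink v (y - x))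
    (hwx : mink w x ≤ 0) (hwy : 0 ≤ mink w y) : 1 ≤ mink v w := by
  rcases le_abs'.1 h with h | h
  · exfalso
    -- If `⟨v, w⟩ ≤ -1` then `v + w` is causal, so it is zero or has one strict sign on the whole
    -- hyperbolic plane. This contradicts its signs at `x` and `y`, one of which is strict by `hv0`.
    have hc : mink (v + w) (v + w) ≤ 0 := by
      simp only [map_add, LinearMap.add_apply]
      rw [mink_comm w v]; linarith
    have h1 : mink (v + w) x ≤ 0 := by simp only [map_add, LinearMap.add_apply]; linarith
    have h2 : 0 ≤ mink (v + w) y := by simp only [map_add, LinearMap.add_apply]; linarith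
    have h3 : mink (v + w) x < 0 ∨ 0 < mink (v + w) y := by
      simp only [map_add, map_sub, LinearMap.add_apply] at *
      by_contra! h3
      linarith
    rcases lt_trichotomy (v + w).2 0 with h0 | h0 | h0
    · have := mink_neg_of_causal (n := -(v + w))
        (by simpa only [map_neg, LinearMap.neg_apply, neg_neg] using hc)
        (by rw [Prod.snd_neg]; linarith) hx
      simp only [map_neg, LinearMap.neg_apply] at this
      linarith
    · have h4 : (v + w).1 = 0 := by
        rw [mink_self, h0] at hc
        have : ‖(v + w).1‖ ^ 2 = 0 := le_antisymm (by linarith) (sq_nonneg _)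
        simpa using this
      have h5 : v + w = 0 := Prod.ext h4 h0
      rw [h5] at h3
      simp at h3
    · have := mink_neg_of_causal hc h0 hy
      linarith
  · exact h

/-! ### Comparison for a second order linear inequality -/

/-- Factor `H'' - H = (d/dt - 1)(d/dt + 1)H`: the integrating factor `exp (-t)` gives `H + H' ≤ 0`,
then `exp t` gives `H ≤ 0`. -/
theorem nonpos_of_deriv_deriv_le {H K K' : ℝ → ℝ} (hH : ∀ t, HasDerivAt H (K t) t)
    (hK : ∀ t, HasDerivAt K (K' t) t) (hK' : ∀ t, K' t ≤ H t) (hH0 : H 0 = 0) (hK0 : K 0 = 0)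
    {t : ℝ} (ht : 0 ≤ t) : H t ≤ 0 := by
  have h1 : Antitone fun s => Real.exp (-s) * (H s + K s) := by
    refine antitone_of_hasDerivAt_nonpos
      (f' := fun s => Real.exp (-s) * (-1) * (H s + K s) + Real.exp (-s) * (K s + K' s))
      (fun s => ((hasDerivAt_neg s).exp).mul ((hH s).add (hK s))) (fun s => ?_)
    simp only [Pi.zero_apply]
    nlinarith [Real.exp_pos (-s), hK' s]
  have h2 : ∀ s, 0 ≤ s → H s + K s ≤ 0 := by
    intro s hs
    have := h1 hs
    simp only [hH0, hK0, add_zero, mul_zero] at this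
    exact nonpos_of_mul_nonpos_right this (Real.exp_pos _)
  have hd : ∀ s, HasDerivAt (fun s => Real.exp s * H s)
      (Real.exp s * H s + Real.exp s * K s) s := fun s => (Real.hasDerivAt_exp s).mul (hH s)
  have h3 : AntitoneOn (fun s => Real.exp s * H s) (Set.Ici 0) := by
    refine antitoneOn_of_deriv_nonpos (convex_Ici 0)
      (fun s _ => (hd s).continuousAt.continuousWithinAt)
      (fun s _ => (hd s).differentiableAt.differentiableWithinAt) (fun s hs => ?_)
    rw [interior_Ici] at hs
    rw [(hd s).deriv, ← mul_add]
    exact mul_nonpos_of_nonneg_of_nonpos (Real.exp_pos _).le (h2 s (le_of_lt hs))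
  have := h3 Set.self_mem_Ici ht ht
  simp only [hH0, mul_zero] at this
  exact nonpos_of_mul_nonpos_right this (Real.exp_pos _)

theorem HasDerivAt.mink {f g : ℝ → Mink} {f' g' : Mink} {t : ℝ} (hf : HasDerivAt f f' t)
    (hg : HasDerivAt g g' t) :
    HasDerivAt (fun s => _root_.mink (f s) (g s)) (_root_.mink f' (g t) + _root_.mink (f t) g')
      t := by
  have hf₁ := (ContinuousLinearMap.fst ℝ Plane ℝ).hasFDerivAt.comp_hasDerivAt t hf
  have hf₂ := (ContinuousLinearMap.snd ℝ Plane ℝ).hasFDerivAt.comp_hasDerivAt t hf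
  have hg₁ := (ContinuousLinearMap.fst ℝ Plane ℝ).hasFDerivAt.comp_hasDerivAt t hg
  have hg₂ := (ContinuousLinearMap.snd ℝ Plane ℝ).hasFDerivAt.comp_hasDerivAt t hg
  have h := (hf₁.inner ℝ hg₁).sub (hf₂.mul hg₂)
  simp only [mink_apply]
  refine h.congr_deriv ?_
  simp
  ring

/-! ### Geodesics of the hyperboloid -/

/-- The unit speed geodesic of the hyperbolic plane from `z` in the direction `w`. -/
noncomputable def hypGeodesic (z w : Mink) (t : ℝ) : Mink := Real.cosh t • z + Real.sinh t • w

theorem hasDerivAt_hypGeodesic (z w : Mink) (t : ℝ) :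
    HasDerivAt (hypGeodesic z w) (hypGeodesic w z t) t := by
  have h := ((Real.hasDerivAt_cosh t).smul_const z).add ((Real.hasDerivAt_sinh t).smul_const w)
  rw [hypGeodesic, add_comm]
  exact h

theorem mink_hypGeodesic_self {z w : Mink} (hw : mink w z = 0) (t : ℝ) :
    mink (hypGeodesic z w t) (hypGeodesic z w t)
      = Real.cosh t ^ 2 * mink z z + Real.sinh t ^ 2 * mink w w := by
  have hzw : mink z w = 0 := by rw [mink_comm, hw]
  simp only [hypGeodesic, map_add, map_smul, LinearMap.add_apply, LinearMap.smul_apply,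
    smul_eq_mul, hw, hzw]
  ring

theorem hypGeodesic_mem {z w : Mink} (hz : z ∈ hyperbolicPlane) (hw : mink w z = 0)
    (hww : mink w w = 1) (t : ℝ) : hypGeodesic z w t ∈ hyperbolicPlane := by
  have h1 : mink (hypGeodesic z w t) (hypGeodesic z w t) = -1 := by
    rw [mink_hypGeodesic_self hw, hz.1, hww]
    linarith [Real.cosh_sq t]
  refine ⟨h1, snd_pos_of_causal (by linarith) hz ?_⟩
  simp only [hypGeodesic, map_add, map_smul, LinearMap.add_apply, LinearMap.smul_apply,
    smul_eq_mul, hw, hz.1]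
  linarith [Real.cosh_pos t]

theorem hyperboloid_lift_mem (y : Plane) :
    ((y, Real.sqrt (1 + ‖y‖ ^ 2)) : Mink) ∈ hyperbolicPlane := by
  have h : 0 < 1 + ‖y‖ ^ 2 := by positivity
  refine ⟨?_, Real.sqrt_pos.2 h⟩
  rw [mink_self]
  simp only [Real.sq_sqrt h.le]
  ring

theorem eq_of_mem_hyperbolicPlane {x y : Mink} (hx : x ∈ hyperbolicPlane)
    (hy : y ∈ hyperbolicPlane) (h : x.1 = y.1) : x = y := by
  refine Prod.ext h ?_
  have h1 := hx.1
  have h2 := hy.1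
  rw [mink_self] at h1 h2
  rw [h] at h1
  exact (sq_eq_sq₀ hx.2.le hy.2.le).1 (by linarith)

/-- A plane orthogonal to a timelike vector contains no vertical direction. Tangent vectors can
therefore be handled through their horizontal parts. -/
theorem eq_zero_of_fst_eq_zero {v z : Mink} (hz : z ∈ hyperbolicPlane) (hv : mink v z = 0)
    (h : v.1 = 0) : v = 0 := by
  refine Prod.ext h ?_
  rw [mink_apply, h, inner_zero_left, zero_sub, neg_eq_zero, mul_eq_zero] at hv
  exact hv.resolve_right hz.2.ne'

/-! ### Convex spacelike surfaces -/

namespace ConvexSpacelikeSurface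

variable (S : ConvexSpacelikeSurface)

/-- The point of the surface over `w`. -/
def lift (w : Plane) : Mink := (w, S.height w)

theorem mink_sub_unitNormal_nonpos {q : Mink} (hq : q ∈ S.carrier) {w : Plane}
    (hw : w ∈ S.base) : mink (q - S.lift w) (S.unitNormal w) ≤ 0 := by
  have h := S.convex w hw q.1 hq.1
  have hs := inv_nonneg.2 (Real.sqrt_nonneg (1 - ‖gradient S.height w‖ ^ 2))
  have h2 := hq.2
  simp only [unitNormal, map_smul, smul_eq_mul]
  refine mul_nonpos_of_nonneg_of_nonpos hs ?_
  rw [mink_apply]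
  simp only [lift, Prod.fst_sub, Prod.snd_sub, mul_one, h2]
  rw [real_inner_comm]
  linarith

/-- The tangent vector of the surface with horizontal part `a`. -/
noncomputable def tangentLift (w a : Plane) : Mink := (a, inner ℝ (gradient S.height w) a)

theorem mink_tangentLift (w a : Plane) : mink (S.tangentLift w a) (S.unitNormal w) = 0 := by
  simp only [unitNormal, map_smul, smul_eq_mul]
  rw [mink_apply]
  simp [tangentLift]

theorem hasDerivAt_lift {w : ℝ → Plane} {w' : Plane} {t : ℝ} (hw : HasDerivAt w w' t)
    (hb : w t ∈ S.base) : HasDerivAt (fun s => S.lift (w s)) (S.tangentLift (w t) w') t := by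
  have hd : DifferentiableAt ℝ S.height (w t) :=
    (S.contDiffOn_height.contDiffAt (S.isOpen_base.mem_nhds hb)).differentiableAt (by norm_num)
  have h := hd.hasGradientAt.hasFDerivAt.comp_hasDerivAt t hw
  exact hw.prodMk h

/-- The horizontal part of the derivative of the normal field, as an equivalence where the shape
operator is invertible. -/
theorem exists_equiv_fderiv_unitNormal {w : Plane} (hw : w ∈ S.base)
    (hB : IsUnit (S.shapeOperator ⟨S.lift w, hw, rfl⟩)) :
    ∃ E : Plane ≃L[ℝ] Plane,
      HasFDerivAt (fun a => (S.unitNormal a).1) (E : Plane →L[ℝ] Plane) w := by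
  have hd := (S.differentiableAt_unitNormal hw).hasFDerivAt.fst
  set A : Plane →L[ℝ] Plane :=
    (ContinuousLinearMap.fst ℝ Plane ℝ).comp (fderiv ℝ S.unitNormal w) with hA
  -- If the horizontal part of `dN(a)` vanishes, so does `dN(a)`, because it is tangent. The tangent
  -- vector over `a` is then in the kernel of the shape operator.
  have hinj : Function.Injective (A : Plane →ₗ[ℝ] Plane) := by
    rw [← LinearMap.ker_eq_bot, LinearMap.ker_eq_bot']
    intro a ha
    have h0 : fderiv ℝ S.unitNormal w a = 0 :=
      eq_zero_of_fst_eq_zero (S.unitNormal_mem hw) (S.mink_fderiv_unitNormal hw a) ha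
    let v : S.tangentPlane ⟨S.lift w, hw, rfl⟩ := ⟨S.tangentLift w a, S.mink_tangentLift w a⟩
    have h1 : S.shapeOperator ⟨S.lift w, hw, rfl⟩ v = 0 := Subtype.ext h0
    have h2 : v = 0 := by
      have h3 := Ring.inverse_mul_cancel _ hB
      have h4 := congrArg (fun T : Module.End ℝ _ => T v) h3
      simp only [Module.End.mul_apply, h1, map_zero, Module.End.one_apply] at h4
      exact h4.symm
    exact congrArg (fun u : S.tangentPlane ⟨S.lift w, hw, rfl⟩ => u.1.1) h2
  refine ⟨(LinearEquiv.ofInjectiveEndo (A : Plane →ₗ[ℝ] Plane) hinj).toContinuousLinearEquiv, ?_⟩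
  exact hd.congr_fderiv (by ext1 a; rfl)

/-- If the Gauss map is a homeomorphism with invertible derivative then its inverse is
differentiable. -/
theorem exists_differentiable_inverse (hG : IsHomeomorph S.gaussMap)
    (hB : ∀ p, IsUnit (S.shapeOperator p)) :
    ∃ ψ : Plane → Plane, Differentiable ℝ ψ ∧
      ∀ x ∈ hyperbolicPlane, ψ x.1 ∈ S.base ∧ S.unitNormal (ψ x.1) = x := by
  let e := hG.homeomorph S.gaussMap
  -- The inverse Gauss map, read in the horizontal projections of both the hyperboloid and the
  -- surface.
  let ψ : Plane → Plane := fun y => (e.symm ⟨_, hyperboloid_lift_mem y⟩).1.1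
  have hψc : Continuous ψ := by
    refine continuous_fst.comp (continuous_subtype_val.comp (e.symm.continuous.comp ?_))
    refine Continuous.subtype_mk ?_ _
    fun_prop
  have hψb : ∀ y, ψ y ∈ S.base := fun y => (e.symm ⟨_, hyperboloid_lift_mem y⟩).2.1
  have hψN : ∀ y, S.unitNormal (ψ y) = (y, Real.sqrt (1 + ‖y‖ ^ 2)) := fun y =>
    congrArg Subtype.val (e.apply_symm_apply ⟨_, hyperboloid_lift_mem y⟩)
  refine ⟨ψ, fun y => ?_, fun x hx => ⟨hψb _, ?_⟩⟩
  · obtain ⟨E, hE⟩ := S.exists_equiv_fderiv_unitNormal (hψb y) (hB _)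
    exact (HasFDerivAt.of_local_left_inverse hψc.continuousAt hE
      (Filter.Eventually.of_forall fun y => by rw [hψN])).differentiableAt
  · rw [hψN]
    exact eq_of_mem_hyperbolicPlane (hyperboloid_lift_mem _) hx rfl

/-! ### Comparison of the surface with hyperboloids of radius `‖B⁻¹‖` -/

theorem isUnit_shapeOperator (h : S.invShapeNorm ≠ ∞) (p : S.carrier) :
    IsUnit (S.shapeOperator p) := by
  by_contra hp
  refine h (top_unique ?_)
  refine le_trans ?_ (le_iSup _ p)
  rw [if_neg hp]

theorem minkNorm_le_of_invShapeNorm (h : S.invShapeNorm ≠ ∞) (p : S.carrier)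
    (v : S.tangentPlane p) (hv : mink (S.shapeOperator p v : Mink) (S.shapeOperator p v) = 1) :
    minkNorm v ≤ S.invShapeNorm.toReal := by
  have hu := S.isUnit_shapeOperator h p
  have h0 : S.shapeOperator p v ≠ 0 := by
    intro h0
    rw [h0] at hv
    simp at hv
  have h1 : ENNReal.ofReal (minkNorm v) ≤ S.invShapeNorm := by
    refine le_trans ?_ (le_iSup _ p)
    rw [if_pos hu]
    refine le_trans ?_ (le_iSup₂ (S.shapeOperator p v) h0)
    have h3 : Ring.inverse (S.shapeOperator p) (S.shapeOperator p v) = v := by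
      have h4 := congrArg (fun T : Module.End ℝ _ => T v) (Ring.inverse_mul_cancel _ hu)
      simpa using h4
    have h5 : minkNorm (S.shapeOperator p v : Mink) = 1 := by rw [minkNorm, hv, Real.sqrt_one]
    rw [h3, h5, div_one]
  exact (ENNReal.ofReal_le_iff_le_toReal h).1 h1

/-- The surface lies in the convex side of each tangent hyperboloid of radius `‖B⁻¹‖`, stated with
the support function along geodesics from the point of tangency. -/
theorem mink_hypGeodesic_le (hG : IsHomeomorph S.gaussMap) (h : S.invShapeNorm ≠ ∞) {z : Mink}
    (hz : z ∈ hyperbolicPlane) :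
    ∃ p ∈ S.carrier, ∀ w, mink w z = 0 → mink w w = 1 → ∀ q ∈ S.carrier, ∀ t, 0 ≤ t →
      mink (q - p) (hypGeodesic z w t) ≤ S.invShapeNorm.toReal * (Real.cosh t - 1) := by
  obtain ⟨ψ, hψd, hψ⟩ := S.exists_differentiable_inverse hG (S.isUnit_shapeOperator h)
  set C := S.invShapeNorm.toReal
  refine ⟨S.lift (ψ z.1), ⟨(hψ z hz).1, rfl⟩, fun w hwz hww q hq t ht => ?_⟩
  set p := S.lift (ψ z.1) with hp
  -- The velocity of `hypGeodesic z w` is `hypGeodesic w z`, since `cosh` and `sinh` exchange under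
  -- differentiation.
  have hX := hasDerivAt_hypGeodesic z w
  have hX' := hasDerivAt_hypGeodesic w z
  have hXm := hypGeodesic_mem hz hwz hww
  let a : ℝ → Plane := fun s => ψ (hypGeodesic z w s).1
  have hab : ∀ s, a s ∈ S.base := fun s => (hψ _ (hXm s)).1
  have haN : ∀ s, S.unitNormal (a s) = hypGeodesic z w s := fun s => (hψ _ (hXm s)).2
  have had : ∀ s, HasDerivAt a (fderiv ℝ ψ (hypGeodesic z w s).1 (hypGeodesic w z s).1) s :=
    fun s => (hψd _).hasFDerivAt.comp_hasDerivAt s (hX s).fst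
  set a' : ℝ → Plane := fun s => fderiv ℝ ψ (hypGeodesic z w s).1 (hypGeodesic w z s).1
  have hγ : ∀ s, HasDerivAt (fun s => S.lift (a s)) (S.tangentLift (a s) (a' s)) s :=
    fun s => S.hasDerivAt_lift (had s) (hab s)
  have hN : ∀ s, fderiv ℝ S.unitNormal (a s) (a' s) = hypGeodesic w z s := by
    intro s
    have h1 := (S.differentiableAt_unitNormal (hab s)).hasFDerivAt.comp_hasDerivAt s (had s)
    have h2 : S.unitNormal ∘ a = hypGeodesic z w := funext haN
    rw [h2] at h1
    exact h1.unique (hX s)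
  have hunit : ∀ s, mink (hypGeodesic w z s) (hypGeodesic w z s) = 1 := by
    intro s
    rw [mink_hypGeodesic_self (by rw [mink_comm, hwz]), hww, hz.1]
    linarith [Real.cosh_sq s]
  -- The tangent vector is the preimage under the shape operator of the unit vector `X'`, so its
  -- norm is at most `C`; Cauchy-Schwarz in the tangent plane finishes.
  have hk : ∀ s, mink (S.tangentLift (a s) (a' s)) (hypGeodesic w z s) ≤ C := by
    intro s
    let v : S.tangentPlane ⟨S.lift (a s), hab s, rfl⟩ :=
      ⟨S.tangentLift (a s) (a' s), S.mink_tangentLift _ _⟩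
    have h1 : (S.shapeOperator ⟨S.lift (a s), hab s, rfl⟩ v : Mink) = hypGeodesic w z s := hN s
    have h2 := S.minkNorm_le_of_invShapeNorm h _ v (by rw [h1]; exact hunit s)
    have h3 := mink_le_minkNorm_mul (S.unitNormal_mem (hab s)) (S.mink_tangentLift (a s) (a' s))
      (S.mink_fderiv_unitNormal (hab s) (a' s))
    rw [hN s, show minkNorm (hypGeodesic w z s) = Real.sqrt 1 by rw [minkNorm, hunit s],
      Real.sqrt_one, mul_one] at h3
    exact h3.trans h2
  have hort : ∀ s, mink (S.tangentLift (a s) (a' s)) (hypGeodesic z w s) = 0 := by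
    intro s
    rw [← haN s]
    exact S.mink_tangentLift _ _
  -- `⟨p, X⟩ + C (cosh - 1)` solves `f'' = f + C` with the same initial value and slope as the
  -- support function. By `hort`, the support function has derivative `⟨γ, X'⟩`, where `γ` is the
  -- surface point with normal `X`.
  have hcomp := nonpos_of_deriv_deriv_le
    (H := fun s => mink (S.lift (a s)) (hypGeodesic z w s) - mink p (hypGeodesic z w s)
      - C * (Real.cosh s - 1))
    (K := fun s => mink (S.lift (a s)) (hypGeodesic w z s) - mink p (hypGeodesic w z s)
      - C * Real.sinh s)
    (K' := fun s => mink (S.tangentLift (a s) (a' s)) (hypGeodesic w z s)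
      + mink (S.lift (a s)) (hypGeodesic z w s) - mink p (hypGeodesic z w s) - C * Real.cosh s)
    (fun s => by
      have h1 := (((hγ s).mink (hX s)).sub ((hasDerivAt_const s p).mink (hX s))).sub
        (((Real.hasDerivAt_cosh s).sub_const 1).const_mul C)
      refine h1.congr_deriv ?_
      rw [hort s]
      simp)
    (fun s => by
      have h1 := (((hγ s).mink (hX' s)).sub ((hasDerivAt_const s p).mink (hX' s))).sub
        ((Real.hasDerivAt_sinh s).const_mul C)
      refine h1.congr_deriv ?_
      simp)
    (fun s => by linarith [hk s])
    (by simp [a, hypGeodesic, hp]) (by simp [a, hypGeodesic, hp]) ht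
  have hq' := S.mink_sub_unitNormal_nonpos hq (hab t)
  rw [haN t] at hq'
  simp only [map_sub, LinearMap.sub_apply] at hq' ⊢
  linarith

/-- The estimate of `mink_hypGeodesic_le` in the limit at infinity. -/
theorem mink_lightlike_le (hG : IsHomeomorph S.gaussMap) (h : S.invShapeNorm ≠ ∞) {z : Mink}
    (hz : z ∈ hyperbolicPlane) :
    ∃ p ∈ S.carrier, ∀ w, mink w z = 0 → mink w w = 1 → ∀ q ∈ S.carrier,
      mink (q - p) (z + w) ≤ S.invShapeNorm.toReal := by
  obtain ⟨p, hp, H⟩ := S.mink_hypGeodesic_le hG h hz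
  refine ⟨p, hp, fun w hwz hww q hq => ?_⟩
  have hC : 0 ≤ S.invShapeNorm.toReal := ENNReal.toReal_nonneg
  set C := S.invShapeNorm.toReal
  set α := mink (q - p) (z + w) with hα
  set β := mink (q - p) (z - w) with hβ
  by_contra! hlt
  -- Along the geodesic the pairing is `(exp t * α + exp (-t) * β) / 2`, so the hyperboloid bound
  -- keeps `exp t * (α - C)` bounded, which is impossible for `α > C`.
  have key : ∀ t, 0 ≤ t → Real.exp t * (α - C) ≤ |C - β| := by
    intro t ht
    have h1 := H w hwz hww q hq t ht
    have h2 : mink (q - p) (hypGeodesic z w t)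
        = (Real.exp t * α + Real.exp (-t) * β) / 2 := by
      simp only [hα, hβ, hypGeodesic, map_add, map_smul, smul_eq_mul, Real.cosh_eq, Real.sinh_eq]
      rw [map_sub (mink (q - p)) z w]
      ring
    rw [h2, Real.cosh_eq] at h1
    have h3 : Real.exp (-t) ≤ 1 := Real.exp_le_one_iff.2 (by linarith)
    have h4 : Real.exp (-t) * (C - β) ≤ |C - β| := by
      calc Real.exp (-t) * (C - β) ≤ Real.exp (-t) * |C - β| :=
            mul_le_mul_of_nonneg_left (le_abs_self _) (Real.exp_pos _).le
        _ ≤ 1 * |C - β| := mul_le_mul_of_nonneg_right h3 (abs_nonneg _)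
        _ = |C - β| := one_mul _
    linarith
  have hpos : 0 < α - C := by linarith
  have h5 := key (|C - β| / (α - C)) (by positivity)
  have h6 := Real.add_one_le_exp (|C - β| / (α - C))
  have h7 := mul_le_mul_of_nonneg_right h6 hpos.le
  rw [add_mul, div_mul_cancel₀ _ hpos.ne'] at h7
  linarith

/-! ### Support planes of the domain of dependence -/

theorem carrier_subset_domainOfDependence : S.carrier ⊆ S.domainOfDependence :=
  fun p hp _ _ _ _ h => h p hp

/-- Since `z + w` is lightlike and future-directed, the bound on `S` describes one of the
half-spaces whose intersection is `D(S)`. -/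
theorem mink_lightlike_le_of_mem_domainOfDependence (hG : IsHomeomorph S.gaussMap)
    (h : S.invShapeNorm ≠ ∞) {z : Mink} (hz : z ∈ hyperbolicPlane) :
    ∃ p ∈ S.carrier, ∀ w, mink w z = 0 → mink w w = 1 → ∀ q ∈ S.domainOfDependence,
      mink (q - p) (z + w) ≤ S.invShapeNorm.toReal := by
  obtain ⟨p, hp, H⟩ := S.mink_lightlike_le hG h hz
  refine ⟨p, hp, fun w hwz hww q hq => ?_⟩
  have h0 : mink (z + w) (z + w) = 0 := by
    simp only [map_add, LinearMap.add_apply]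
    rw [mink_comm z w, hwz, hz.1, hww]; ring
  have h1 := hq (z + w) (mink p (z + w) + S.invShapeNorm.toReal) h0
    (snd_pos_of_causal h0.le hz (by
      simp only [map_add, LinearMap.add_apply, hwz, hz.1]; norm_num))
    (fun q' hq' => by
      have := H w hwz hww q' hq'
      rw [map_sub, LinearMap.sub_apply] at this
      linarith)
  rw [map_sub, LinearMap.sub_apply]
  linarith

/-- The points at which two close support planes touch the domain of dependence are close. -/
theorem mink_sub_self_le (hG : IsHomeomorph S.gaussMap) (h : S.invShapeNorm ≠ ∞)
    {x x' y y' : Mink} (hx : x ∈ hyperbolicPlane) (hx' : x' ∈ hyperbolicPlane)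
    (hxx' : -(5 / 3) ≤ mink x x') (hy : IsSupportPlaneAt S.domainOfDependence y x)
    (hy' : IsSupportPlaneAt S.domainOfDependence y' x') :
    mink (y' - y) (y' - y) ≤ (4 * S.invShapeNorm.toReal) ^ 2 := by
  have hc := mink_le_neg_one hx hx'
  have hcc := mink_comm x' x
  set c := -(mink x x') with hcdef
  have hmc : mink x x' = -c := by rw [hcdef, neg_neg]
  have hs : mink (x + x') (x + x') = -(2 * (1 + c)) := by
    simp only [map_add, LinearMap.add_apply, hx.1, hx'.1, hcc, hmc]; ring
  have hd : mink (x' - x) (x' - x) = 2 * (c - 1) := by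
    simp only [map_sub, LinearMap.sub_apply, hx.1, hx'.1, hcc, hmc]; ring
  have hds : mink (x' - x) (x + x') = 0 := by
    simp only [map_sub, map_add, LinearMap.sub_apply, hx.1, hx'.1, hcc, hmc]; ring
  have hz := smul_mem_hyperbolicPlane (n := x + x') (by rw [hs]; linarith)
    (add_pos hx.2 hx'.2)
  rw [hs, neg_neg] at hz
  set r := Real.sqrt (2 * (1 + c)) with hr
  have hr0 : 0 < r := Real.sqrt_pos.2 (by linarith)
  have hr2 : r ^ 2 = 2 * (1 + c) := Real.sq_sqrt (by linarith)
  -- The midpoint of `[x, x']`. The support planes at `x` and `x'` together control the height of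
  -- `p` in this direction.
  set z := r⁻¹ • (x + x') with hzdef
  set e := y' - y with he
  obtain ⟨p, hp, H⟩ := S.mink_lightlike_le_of_mem_domainOfDependence hG h hz
  have hC : 0 ≤ S.invShapeNorm.toReal := ENNReal.toReal_nonneg
  set C := S.invShapeNorm.toReal
  -- Add the lightlike bounds for `y'` along `z + w` and for `y` along `z - w`, then eliminate `p`
  -- by the support planes. The error term comes from `⟨y + y', x + x'⟩ = 2(⟨y, x⟩ + ⟨y', x'⟩) - ⟨e,
  -- x' - x⟩`.
  have hw : ∀ w, mink w z = 0 → mink w w = 1 → mink e w ≤ 2 * C + r⁻¹ * mink e (x' - x) := by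
    intro w hwz hww
    have h1 := H w hwz hww y' hy'.1
    have h2 := H (-w) (by simp [hwz]) (by simp [hww]) y hy.1
    have h3 := hy.2 p (S.carrier_subset_domainOfDependence hp)
    have h4 := hy'.2 p (S.carrier_subset_domainOfDependence hp)
    have h5 := mul_le_mul_of_nonneg_left (add_le_add h3 h4) (inv_pos.2 hr0).le
    simp only [he, hzdef, map_add, map_sub, map_neg, map_smul, LinearMap.sub_apply,
      smul_eq_mul] at h1 h2 h5 ⊢
    linarith
  have hzz := hz.1
  have hdz : mink (x' - x) z = 0 := by rw [hzdef, map_smul, hds, smul_zero]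
  -- The projection of `e` to the spacelike plane `z^⊥`; it only increases the square, and its
  -- direction is the best choice of `w`.
  set u := e + mink e z • z with hu
  have huz : mink u z = 0 := by
    simp only [hu, map_add, map_smul, LinearMap.add_apply, LinearMap.smul_apply, smul_eq_mul, hzz]
    ring
  have heu : mink e u = mink e e + mink e z ^ 2 := by
    simp only [hu, map_add, map_smul, smul_eq_mul]; ring
  have huu : mink u u = mink e e + mink e z ^ 2 := by
    have : mink u u = mink e u + mink e z * mink z u := by
      conv_lhs => rw [hu]
      simp only [map_add, map_smul, LinearMap.add_apply, LinearMap.smul_apply, smul_eq_mul, hu]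
      ring
    rw [this, mink_comm z u, huz, heu]; ring
  have hle : mink e e ≤ mink u u := by rw [huu]; nlinarith [sq_nonneg (mink e z)]
  have hu0 := mink_self_nonneg_of_orthogonal hz huz
  rcases hu0.eq_or_lt with hu0 | hu0
  · rw [← hu0] at hle
    exact hle.trans (sq_nonneg _)
  set A := Real.sqrt (mink u u) with hA
  have hA0 : 0 < A := Real.sqrt_pos.2 hu0
  have hA2 : A ^ 2 = mink u u := Real.sq_sqrt hu0.le
  have h1 := hw (A⁻¹ • u) (by simp [huz]) (by
    simp only [map_smul, LinearMap.smul_apply, smul_eq_mul, ← hA2]; field_simp)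
  have h2 : mink e (A⁻¹ • u) = A := by
    rw [map_smul, heu, ← huu, ← hA2, smul_eq_mul]; field_simp
  have h3 : mink e (x' - x) = mink u (x' - x) := by
    rw [hu, map_add, LinearMap.add_apply, map_smul, LinearMap.smul_apply, mink_comm z, hdz]; simp
  -- The ratio `|x' - x| / r` is `tanh (d(x, x') / 2)`, and `c ≤ 5/3` says exactly that it is at
  -- most `1/2`. The error is then absorbed: `A ≤ 2C + A/2`.
  have h4 : r⁻¹ * mink u (x' - x) ≤ A / 2 := by
    have h5 := mink_sq_le_of_orthogonal hz huz hdz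
    rw [hd, ← hA2] at h5
    have h6 : mink u (x' - x) ≤ A * r / 2 := by
      refine le_of_sq_le_sq (h5.trans ?_) (by positivity)
      have : (A * r / 2) ^ 2 = A ^ 2 * ((1 + c) / 2) := by
        rw [div_pow, mul_pow, hr2]; ring
      rw [this]
      exact mul_le_mul_of_nonneg_left (by linarith) (sq_nonneg A)
    calc r⁻¹ * mink u (x' - x) ≤ r⁻¹ * (A * r / 2) :=
          mul_le_mul_of_nonneg_left h6 (inv_pos.2 hr0).le
      _ = A / 2 := by field_simp
  rw [h2, h3] at h1
  calc mink e e ≤ A ^ 2 := hle.trans hA2.symm.le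
    _ ≤ (4 * C) ^ 2 := pow_le_pow_left₀ hA0.le (by linarith) 2

end ConvexSpacelikeSurface

/-! ### The space of geodesics -/

theorem continuous_mink_left (x : Mink) : Continuous fun v : Mink => mink v x := by
  simp only [mink_apply]
  fun_prop

theorem mink_smul_add_smul_self_neg {x y : Mink} (hx : x ∈ hyperbolicPlane)
    (hy : y ∈ hyperbolicPlane) {a b : ℝ} (ha : 0 ≤ a) (hb : 0 ≤ b) (hab : 0 < a + b) :
    mink (a • x + b • y) (a • x + b • y) < 0 := by
  have h := mink_le_neg_one hx hy
  simp only [map_add, map_smul, LinearMap.add_apply, LinearMap.smul_apply, smul_eq_mul, hx.1, hy.1]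
  rw [mink_comm y x]
  have hp : 0 < (a + b) * (a + b) := by positivity
  nlinarith [mul_nonneg ha hb]

theorem left_mem_geodesicSegment {x y : Mink} (hx : x ∈ hyperbolicPlane) :
    x ∈ geodesicSegment x y :=
  ⟨hx, 1, 0, zero_le_one, le_rfl, by simp⟩

theorem right_mem_geodesicSegment {x y : Mink} (hy : y ∈ hyperbolicPlane) :
    y ∈ geodesicSegment x y :=
  ⟨hy, 0, 1, le_rfl, zero_le_one, by simp⟩

namespace Geodesic

/-- The geodesic orthogonal to a unit spacelike vector. -/
def mk (v : deSitter) : Geodesic := Quotient.mk geodesicSetoid v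

theorem exists_mk (l : Geodesic) : ∃ v, mk v = l := Quotient.exists_rep l

theorem normal_mk (x y : Mink) (v : deSitter) :
    normal x y (mk v) = Real.sign (mink v (y - x)) • (v : Mink) := rfl

theorem exists_mk_mink_neg (l : Geodesic) {x : Mink} (hx : x ∈ hyperbolicPlane)
    (hl : x ∉ l.points) : ∃ v, mk v = l ∧ mink v x < 0 := by
  obtain ⟨v, rfl⟩ := l.exists_mk
  have h0 : mink v x ≠ 0 := fun h => hl ⟨hx, h⟩
  rcases h0.lt_or_gt with h | h
  · exact ⟨v, rfl, h⟩
  · have hv : mink (-(v : Mink)) (-(v : Mink)) = 1 := by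
      simpa only [map_neg, LinearMap.neg_apply, neg_neg]
        using show mink (v : Mink) v = 1 from v.2
    refine ⟨⟨-v, hv⟩, Quotient.sound (s := geodesicSetoid) (Or.inr rfl), ?_⟩
    simpa using h

/-- Makes the support of a measure conull. The quotient map is open, as the saturation of `U` is `U
∪ -U`. -/
instance : SecondCountableTopology Geodesic := by
  have hneg : ∀ v : deSitter, mink (-(v : Mink)) (-(v : Mink)) = 1 := fun v => by
    simpa only [map_neg, LinearMap.neg_apply, neg_neg]
      using show mink (v : Mink) v = 1 from v.2
  let ν : deSitter → deSitter := fun v => ⟨-v, hneg v⟩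
  have hν : Continuous ν := Continuous.subtype_mk (continuous_subtype_val.neg) _
  have hq : Topology.IsQuotientMap mk := isQuotientMap_quot_mk
  refine hq.secondCountableTopology fun U hU => ?_
  rw [← hq.isOpen_preimage]
  have : mk ⁻¹' (mk '' U) = U ∪ ν ⁻¹' U := by
    ext v
    simp only [Set.mem_preimage, Set.mem_image, Set.mem_union]
    constructor
    · rintro ⟨w, hw, hwv⟩
      rcases (Quotient.exact (s := geodesicSetoid) hwv : (w : Mink) = v ∨ (w : Mink) = -v)
        with h | h
      · exact Or.inl (Subtype.ext h ▸ hw)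
      · have : ν v = w := Subtype.ext h.symm
        exact Or.inr (this ▸ hw)
    · rintro (h | h)
      · exact ⟨v, h, rfl⟩
      · exact ⟨ν v, h, Quotient.sound (s := geodesicSetoid) (Or.inr rfl)⟩
  rw [this]
  exact hU.union (hU.preimage hν)

/-- The product `⟨v, x⟩⟨v, y⟩` for a unit normal `v` of the geodesic: it is negative when `x` and `y`
lie strictly on different sides. -/
noncomputable def side (x y : Mink) (l : Geodesic) : ℝ :=
  Quotient.lift (s := geodesicSetoid) (fun v : deSitter => mink v x * mink v y)
    (by
      rintro v w (h | h)
      · simp only [h]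
      · simp only [h, map_neg, LinearMap.neg_apply, neg_mul_neg]) l

theorem side_mk (x y : Mink) (v : deSitter) : side x y (mk v) = mink v x * mink v y := rfl

theorem continuous_side (x y : Mink) : Continuous (side x y) :=
  Continuous.quotient_lift (((continuous_mink_left x).comp continuous_subtype_val).mul
    ((continuous_mink_left y).comp continuous_subtype_val)) _

/-- The vector `⟨v, x⟩ v` for a unit normal `v` of the geodesic. -/
noncomputable def scaledNormal (x : Mink) (l : Geodesic) : Mink :=
  Quotient.lift (s := geodesicSetoid) (fun v : deSitter => mink v x • (v : Mink))
    (by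
      rintro v w (h | h)
      · simp only [h]
      · simp only [h, map_neg, LinearMap.neg_apply, neg_smul_neg]) l

theorem continuous_scaledNormal (x : Mink) : Continuous (scaledNormal x) :=
  Continuous.quotient_lift (((continuous_mink_left x).comp continuous_subtype_val).smul
    continuous_subtype_val) _

/-- Writing the sign of `s` as `s / |s|` expresses the normal through continuous functions on the
quotient, whence its measurability. At `s = 0` both sides vanish. -/
theorem normal_eq (x y : Mink) (l : Geodesic) :
    normal x y l = (Real.sqrt (side (y - x) (y - x) l))⁻¹ • scaledNormal (y - x) l := by
  obtain ⟨v, rfl⟩ := l.exists_mk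
  rw [normal_mk, side_mk, Real.sqrt_mul_self_eq_abs]
  change _ = _ • (mink v (y - x) • (v : Mink))
  rw [smul_smul]
  congr 1
  rcases lt_trichotomy (mink v (y - x)) 0 with h | h | h
  · rw [Real.sign_of_neg h, abs_of_neg h, inv_neg, neg_mul, inv_mul_cancel₀ h.ne]
  · rw [h]; simp
  · rw [Real.sign_of_pos h, abs_of_pos h, inv_mul_cancel₀ h.ne']

theorem measurable_normal (x y : Mink) : Measurable (normal x y) := by
  have h : normal x y = fun l =>
      (Real.sqrt (side (y - x) (y - x) l))⁻¹ • scaledNormal (y - x) l := funext (normal_eq x y)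
  rw [h]
  exact ((continuous_side _ _).measurable.sqrt.inv).smul (continuous_scaledNormal _).measurable

/-- The linear form `⟨v, ·⟩` vanishes somewhere on the segment exactly when its end values do not
have the same strict sign. -/
theorem meeting_geodesicSegment {x y : Mink} (hx : x ∈ hyperbolicPlane)
    (hy : y ∈ hyperbolicPlane) : meeting (geodesicSegment x y) = {l | side x y l ≤ 0} := by
  ext l
  obtain ⟨v, rfl⟩ := l.exists_mk
  simp only [Set.mem_ofPred_eq, side_mk]
  constructor
  · rintro ⟨z, ⟨hz, hvz⟩, -, a, b, ha, hb, rfl⟩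
    by_contra! hpos
    simp only [map_add, map_smul, smul_eq_mul] at hvz
    have hab : a ≠ 0 ∨ b ≠ 0 := by
      by_contra! h
      have := hz.2
      simp [h.1, h.2] at this
    have h1 : a * (mink v x * mink v x) + b * (mink v x * mink v y) = 0 := by
      linear_combination mink v x * hvz
    have hx0 : 0 < mink v x * mink v x := by
      have : mink v x ≠ 0 := by rintro h; simp [h] at hpos
      exact mul_self_pos.2 this
    have h2 := mul_nonneg ha hx0.le
    have h3 := mul_nonneg hb hpos.le
    rcases hab with h | h
    · have := mul_pos (ha.lt_of_ne' h) hx0; linarith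
    · have := mul_pos (hb.lt_of_ne' h) hpos; linarith
  · intro h
    by_cases h0 : mink v x = 0
    · exact ⟨x, ⟨hx, h0⟩, left_mem_geodesicSegment hx⟩
    · have hab : 0 < |mink v y| + |mink v x| := by positivity
      have hn := mink_smul_add_smul_self_neg hx hy (abs_nonneg (mink v y))
        (abs_nonneg (mink v x)) hab
      have hn0 : 0 < (|mink v y| • x + |mink v x| • y).2 := by
        have h1 := mul_nonneg (abs_nonneg (mink v y)) hx.2.le
        have h2 := mul_pos (abs_pos.2 h0) hy.2
        simp only [Prod.snd_add, Prod.smul_snd, smul_eq_mul]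
        linarith
      have hm := smul_mem_hyperbolicPlane hn hn0
      refine ⟨_, ⟨hm, ?_⟩, hm, _, _, ?_, ?_, by rw [smul_add, smul_smul, smul_smul]⟩
      · simp only [map_add, map_smul, smul_eq_mul]
        refine mul_eq_zero_of_right _ ?_
        rcases mul_nonpos_iff.1 h with ⟨h1, h2⟩ | ⟨h1, h2⟩
        · rw [abs_of_nonneg h1, abs_of_nonpos h2]; ring
        · rw [abs_of_nonpos h1, abs_of_nonneg h2]; ring
      · positivity
      · positivity

/-- The unit normals of the geodesics meeting a segment are bounded. -/
theorem exists_norm_le {x y : Mink} (hx : x ∈ hyperbolicPlane) (hy : y ∈ hyperbolicPlane) :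
    ∃ R, ∀ v ∈ deSitter, mink v x * mink v y ≤ 0 → ‖v‖ ≤ R := by
  have hxl := norm_fst_lt_of_mem_hyperbolicPlane hx
  have hyl := norm_fst_lt_of_mem_hyperbolicPlane hy
  -- A common slope bound for `x` and `y`. Opposite signs of `v` at them force `|v.2| ≤ r ‖v.1‖`,
  -- and `⟨v, v⟩ = 1` then bounds `v.1`.
  set r := max (‖x.1‖ / x.2) (‖y.1‖ / y.2) with hr
  have hr0 : 0 ≤ r := le_max_of_le_left (div_nonneg (norm_nonneg _) hx.2.le)
  have hr1 : r < 1 := max_lt ((div_lt_one hx.2).2 hxl) ((div_lt_one hy.2).2 hyl)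
  have hxr : ‖x.1‖ ≤ r * x.2 := (div_le_iff₀ hx.2).1 (le_max_left _ _)
  have hyr : ‖y.1‖ ≤ r * y.2 := (div_le_iff₀ hy.2).1 (le_max_right _ _)
  have upper : ∀ (v u : Mink), u ∈ hyperbolicPlane → ‖u.1‖ ≤ r * u.2 → 0 ≤ mink v u →
      v.2 ≤ r * ‖v.1‖ := by
    intro v u hu hur h
    rw [mink_apply] at h
    have h1 := real_inner_le_norm v.1 u.1
    have h2 := mul_le_mul_of_nonneg_left hur (norm_nonneg v.1)
    refine le_of_mul_le_mul_right ?_ hu.2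
    linarith
  have lower : ∀ (v u : Mink), u ∈ hyperbolicPlane → ‖u.1‖ ≤ r * u.2 → mink v u ≤ 0 →
      -(r * ‖v.1‖) ≤ v.2 := by
    intro v u hu hur h
    have := upper (-v) u hu hur (by simpa using h)
    rw [Prod.fst_neg, Prod.snd_neg, norm_neg] at this
    linarith
  refine ⟨Real.sqrt (1 / (1 - r ^ 2)), fun v hv h => ?_⟩
  have hv2 : |v.2| ≤ r * ‖v.1‖ := by
    rw [abs_le]
    rcases mul_nonpos_iff.1 h with ⟨h1, h2⟩ | ⟨h1, h2⟩
    · exact ⟨lower v y hy hyr h2, upper v x hx hxr h1⟩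
    · exact ⟨lower v x hx hxr h1, upper v y hy hyr h2⟩
  have hv1 : ‖v.1‖ ≤ Real.sqrt (1 / (1 - r ^ 2)) := by
    refine Real.le_sqrt_of_sq_le ?_
    rw [le_div_iff₀ (by nlinarith)]
    have h1 : mink v v = 1 := hv
    rw [mink_self, ← sq_abs v.2] at h1
    have h2 := pow_le_pow_left₀ (abs_nonneg v.2) hv2 2
    rw [mul_pow] at h2
    linarith
  refine (Prod.norm_def v).trans_le (max_le hv1 ?_)
  rw [Real.norm_eq_abs]
  nlinarith [norm_nonneg v.1]

/-- The image of a closed bounded subset of de Sitter space; a locally finite measure is therefore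
finite on the geodesics meeting a segment. -/
theorem isCompact_side_nonpos {x y : Mink} (hx : x ∈ hyperbolicPlane) (hy : y ∈ hyperbolicPlane) :
    IsCompact {l | side x y l ≤ 0} := by
  obtain ⟨R, hR⟩ := exists_norm_le hx hy
  have hK : IsCompact {v : Mink | mink v v = 1 ∧ mink v x * mink v y ≤ 0} := by
    refine Metric.isCompact_of_isClosed_isBounded ?_ ?_
    · have h1 : Continuous fun v : Mink => mink v v := by simp only [mink_apply]; fun_prop
      exact (isClosed_eq h1 continuous_const).inter
        (isClosed_le ((continuous_mink_left x).mul (continuous_mink_left y)) continuous_const)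
    · exact (Metric.isBounded_closedBall (x := (0 : Mink)) (r := R)).subset fun v hv => by
        simpa using hR v hv.1 hv.2
  have hK' : IsCompact {v : deSitter | mink v x * mink v y ≤ 0} := by
    rw [Subtype.isCompact_iff]
    convert hK using 1
    ext v
    constructor
    · rintro ⟨u, hu, rfl⟩
      exact ⟨u.2, hu⟩
    · rintro ⟨h1, h2⟩
      exact ⟨⟨v, h1⟩, h2, rfl⟩
  have hc : Continuous mk := continuous_quot_mk
  convert hK'.image hc using 1
  ext l
  obtain ⟨v, rfl⟩ := l.exists_mk
  constructor
  · exact fun h => ⟨v, h, rfl⟩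
  · rintro ⟨w, hw, hwv⟩
    rw [← hwv]
    exact hw

theorem measurableSet_side_nonpos (x y : Mink) : MeasurableSet {l | side x y l ≤ 0} :=
  (isClosed_le (continuous_side x y) continuous_const).measurableSet

theorem measurableSet_side_neg (x y : Mink) : MeasurableSet {l | side x y l < 0} :=
  (isOpen_lt (continuous_side x y) continuous_const).measurableSet

theorem measure_side_nonpos_lt_top (μ : Measure Geodesic) [IsLocallyFiniteMeasure μ] {x y : Mink}
    (hx : x ∈ hyperbolicPlane) (hy : y ∈ hyperbolicPlane) : μ {l | side x y l ≤ 0} < ∞ :=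
  (isCompact_side_nonpos hx hy).measure_lt_top

/-- The oriented normal of a geodesic that meets the segment from `x` to `y`, and `0` for the other
geodesics. -/
noncomputable def crossing (x y : Mink) : Geodesic → Mink :=
  Set.indicator {l | side x y l ≤ 0} (normal x y)

theorem integrable_crossing (μ : Measure Geodesic) [IsLocallyFiniteMeasure μ] {x y : Mink}
    (hx : x ∈ hyperbolicPlane) (hy : y ∈ hyperbolicPlane) : Integrable (crossing x y) μ := by
  obtain ⟨R, hR⟩ := exists_norm_le hx hy
  rw [crossing, integrable_indicator_iff (measurableSet_side_nonpos x y)]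
  refine Measure.integrableOn_of_bounded (M := R) (measure_side_nonpos_lt_top μ hx hy).ne
    (measurable_normal x y).aestronglyMeasurable ?_
  refine (ae_restrict_iff' (measurableSet_side_nonpos x y)).2 (Filter.Eventually.of_forall ?_)
  intro l hl
  obtain ⟨v, rfl⟩ := l.exists_mk
  have h := hR v v.2 hl
  rw [normal_mk, norm_smul]
  have hs : ‖Real.sign (mink v (y - x))‖ ≤ 1 := by
    rcases Real.sign_apply_eq (mink v (y - x)) with h | h | h <;> rw [h] <;> simp
  calc _ ≤ 1 * ‖(v : Mink)‖ := mul_le_mul_of_nonneg_right hs (norm_nonneg _)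
    _ ≤ R := by rwa [one_mul]

theorem crossing_mk_of_neg {x y : Mink} {v : deSitter} (hv : mink v x < 0) :
    crossing x y (mk v) = if 0 ≤ mink v y then (v : Mink) else 0 := by
  split_ifs with h
  · rw [crossing, Set.indicator_of_mem, normal_mk, Real.sign_of_pos, one_smul]
    · rw [map_sub]; linarith
    · exact mul_nonpos_of_nonpos_of_nonneg hv.le h
  · refine Set.indicator_of_notMem ?_ _
    push Not at h
    simp only [Set.mem_ofPred_eq, side_mk, not_le]
    exact mul_pos_of_neg_of_neg hv h

/-- `u` is a unit normal of `l` pointing from `x` to `y`. -/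
def IsOrientedNormal (x y : Mink) (l : Geodesic) (u : Mink) : Prop :=
  mink u u = 1 ∧ mink u x ≤ 0 ∧ 0 ≤ mink u y ∧ 0 < mink u (y - x) ∧
    ∀ z ∈ hyperbolicPlane, mink u z = 0 → z ∈ l.points

/-- Orient the normal `v` to be negative at `x₀`. The difference is `0` if `v` has the same sign at
`x` and `y`, and `±v` otherwise, where the value `0` counts as positive. -/
theorem crossing_sub_crossing {x₀ x y : Mink} (hx₀ : x₀ ∈ hyperbolicPlane) {l : Geodesic}
    (hl : x₀ ∉ l.points) :
    (crossing x₀ y l - crossing x₀ x l = 0 ∧ 0 ≤ side x y l) ∨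
      IsOrientedNormal x y l (crossing x₀ y l - crossing x₀ x l) := by
  obtain ⟨v, rfl, hv⟩ := l.exists_mk_mink_neg hx₀ hl
  have hv1 : mink (v : Mink) v = 1 := v.2
  rw [crossing_mk_of_neg hv, crossing_mk_of_neg hv, side_mk]
  by_cases hx : 0 ≤ mink v x <;> by_cases hy : 0 ≤ mink v y
  · left
    rw [if_pos hx, if_pos hy]
    exact ⟨sub_self _, mul_nonneg hx hy⟩
  · right
    rw [if_pos hx, if_neg hy, zero_sub]
    push Not at hy
    refine ⟨by simpa using hv1, by simpa using hx, by simpa using hy.le, ?_, fun z hz h => ⟨hz, ?_⟩⟩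
    · simp only [map_neg, map_sub, LinearMap.neg_apply]; linarith
    · simpa using h
  · right
    rw [if_neg hx, if_pos hy, sub_zero]
    push Not at hx
    exact ⟨hv1, hx.le, hy, by rw [map_sub]; linarith, fun z hz h => ⟨hz, h⟩⟩
  · left
    rw [if_neg hx, if_neg hy]
    push Not at hx hy
    exact ⟨sub_self _, (mul_pos_of_neg_of_neg hx hy).le⟩

end Geodesic

/-! ### Mass of the lamination and the vector between dual points -/

open Geodesic in
theorem laminationPoint_eq (μ : Measure Geodesic) {x₀ x : Mink} (y₀ : Mink)
    (hx₀ : x₀ ∈ hyperbolicPlane) (hx : x ∈ hyperbolicPlane) :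
    laminationPoint μ x₀ y₀ x = y₀ + ∫ l, crossing x₀ x l ∂μ := by
  rw [laminationPoint, meeting_geodesicSegment hx₀ hx, crossing,
    integral_indicator (measurableSet_side_nonpos x₀ x)]

theorem mink_integral {μ : Measure Geodesic} {f : Geodesic → Mink} (hf : Integrable f μ)
    (a : Mink) : mink a (∫ l, f l ∂μ) = ∫ l, mink a (f l) ∂μ :=
  ((LinearMap.toContinuousLinearMap (mink a)).integral_comp_comm hf).symm

theorem integrable_mink {μ : Measure Geodesic} {f : Geodesic → Mink} (hf : Integrable f μ)
    (a : Mink) : Integrable (fun l => mink a (f l)) μ :=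
  (LinearMap.toContinuousLinearMap (mink a)).integrable_comp hf

open Geodesic in
/-- The mass of a lamination between `x` and `y` is at most the length of the vector joining the
corresponding points of the dual domain. -/
theorem IsMeasuredLamination.sq_measure_le {μ : Measure Geodesic} (hμ : IsMeasuredLamination μ)
    {x₀ x y : Mink} (y₀ : Mink) (hx₀ : x₀ ∈ hyperbolicPlane)
    (hatom : ∀ l : Geodesic, x₀ ∈ l.points → μ {l} = 0)
    (hx : x ∈ hyperbolicPlane) (hy : y ∈ hyperbolicPlane) :
    μ.real {l | side x y l < 0} ^ 2 ≤
      mink (laminationPoint μ x₀ y₀ y - laminationPoint μ x₀ y₀ x)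
        (laminationPoint μ x₀ y₀ y - laminationPoint μ x₀ y₀ x) := by
  have := hμ.1
  set D : Geodesic → Mink := fun l => crossing x₀ y l - crossing x₀ x l with hD
  have hDi : Integrable D μ := (integrable_crossing μ hx₀ hy).sub (integrable_crossing μ hx₀ hx)
  have he : laminationPoint μ x₀ y₀ y - laminationPoint μ x₀ y₀ x = ∫ l, D l ∂μ := by
    rw [laminationPoint_eq μ y₀ hx₀ hy, laminationPoint_eq μ y₀ hx₀ hx, add_sub_add_left_eq_sub,
      integral_sub (integrable_crossing μ hx₀ hy) (integrable_crossing μ hx₀ hx)]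
  rw [he]
  set e := ∫ l, D l ∂μ
  set T := {l | side x y l < 0} with hT
  have hTm : MeasurableSet T := measurableSet_side_neg x y
  have hTfin : μ T ≠ ∞ := ((measure_mono fun l (hl : side x y l < 0) => hl.le).trans_lt
    (measure_side_nonpos_lt_top μ hx hy)).ne
  -- Leaves are disjoint, so at most one passes through `x₀`, and it has no weight.
  have hx₀null : μ {l | l ∈ μ.support ∧ x₀ ∈ l.points} = 0 := by
    have hsub : {l | l ∈ μ.support ∧ x₀ ∈ l.points}.Subsingleton := by
      intro l hl l' hl'
      by_contra hne
      exact (hμ.2.2 l hl.1 l' hl'.1 hne).ne_of_mem hl.2 hl'.2 rfl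
    rcases hsub.eq_empty_or_singleton with h | ⟨l, h⟩
    · rw [h, measure_empty]
    · rw [h]
      exact hatom l (h.symm ▸ rfl : l ∈ {l | l ∈ μ.support ∧ x₀ ∈ l.points}).2
  have hgood : ∀ᵐ l ∂μ, l ∈ μ.support ∧ x₀ ∉ l.points := by
    have h1 : ∀ᵐ l ∂μ, ¬ (l ∈ μ.support ∧ x₀ ∈ l.points) := measure_eq_zero_iff_ae_notMem.1 hx₀null
    filter_upwards [Measure.support_mem_ae (μ := μ), h1] with l hl hl'
    exact ⟨hl, fun h => hl' ⟨hl, h⟩⟩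
  have hcase := fun (l : Geodesic) (hl : x₀ ∉ l.points) =>
    crossing_sub_crossing (x := x) (y := y) hx₀ hl
  have hpair : ∀ l ∈ μ.support, ∀ l' ∈ μ.support, IsOrientedNormal x y l (D l) →
      IsOrientedNormal x y l' (D l') → 1 ≤ mink (D l) (D l') := by
    intro l hl l' hl' h h'
    by_cases hll : l = l'
    · rw [← hll, h.1]
    · have hdis := hμ.2.2 l hl l' hl' hll
      refine one_le_mink_of_crossing hx hy h.1 h'.1 ?_ h.2.1 h.2.2.1 h.2.2.2.1 h'.2.1 h'.2.2.1
      refine one_le_abs_mink_of_disjoint h.1 h'.1 fun z hz h1 h2 => ?_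
      exact hdis.ne_of_mem (h.2.2.2.2 z hz h1) (h'.2.2.2.2 z hz h2) rfl
  have hTi : ∫ l, T.indicator (fun _ => (1 : ℝ)) l ∂μ = μ.real T := by
    rw [integral_indicator_const _ hTm, smul_eq_mul, mul_one]
  have hTint : Integrable (T.indicator fun _ => (1 : ℝ)) μ :=
    (integrable_indicator_iff hTm).2 (integrableOn_const hTfin)
  -- The first of two integrations of `⟨D l, D l'⟩`: the pairing is at least `1` when `l'` strictly
  -- separates `x` from `y`, and nonnegative for almost every other `l'`. Integrating over `l` gives
  -- the square.
  have h1 : ∀ l ∈ μ.support, IsOrientedNormal x y l (D l) → μ.real T ≤ mink (D l) e := by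
    intro l hl h
    rw [mink_integral hDi, ← hTi]
    refine integral_mono_ae hTint (integrable_mink hDi _) ?_
    filter_upwards [hgood] with l' hl'
    rcases hcase l' hl'.2 with ⟨h0, hs⟩ | h'
    · rw [Set.indicator_of_notMem (show l' ∉ T from not_lt.2 hs)]
      simp only [hD, h0, map_zero, le_refl]
    · exact (Set.indicator_le_self' (fun _ _ => zero_le_one) l').trans (hpair l hl l' hl'.1 h h')
  have h2 : ∀ᵐ l ∂μ, μ.real T * T.indicator (fun _ => (1 : ℝ)) l ≤ mink e (D l) := by
    filter_upwards [hgood] with l hl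
    rcases hcase l hl.2 with ⟨h0, hs⟩ | h'
    · rw [Set.indicator_of_notMem (show l ∉ T from not_lt.2 hs)]
      simp only [hD, h0, map_zero, mul_zero, le_refl]
    · rw [mink_comm]
      refine le_trans ?_ (h1 l hl.1 h')
      exact mul_le_of_le_one_right measureReal_nonneg
        (Set.indicator_le_self' (fun _ _ => zero_le_one) l)
  have h3 := integral_mono_ae (hTint.const_mul (μ.real T)) (integrable_mink hDi e) h2
  rw [integral_const_mul, hTi, ← mink_integral hDi] at h3
  rw [sq]
  exact h3

/-! ### The estimate of the Thurston norm -/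

open Geodesic

theorem cosh_one_le : Real.cosh 1 ≤ 31 / 20 := by
  have h1 := Real.exp_one_lt_d9
  have h2 := Real.exp_one_gt_d9
  have h3 : Real.exp (-1) ≤ 2 / 5 - 3 / 100 := by
    rw [Real.exp_neg]
    refine inv_le_of_inv_le₀ (by norm_num) ?_
    norm_num
    linarith
  rw [Real.cosh_eq]
  linarith

/-- A segment of length at most `1` can be prolonged slightly, so that the geodesics through its end
points separate the new end points. -/
theorem exists_prolongation {x y : Mink} (hx : x ∈ hyperbolicPlane) (hy : y ∈ hyperbolicPlane)
    (hxy : -(31 / 20) ≤ mink x y) :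
    ∃ x' ∈ hyperbolicPlane, ∃ y' ∈ hyperbolicPlane, -(5 / 3) ≤ mink x' y' ∧
      ∀ l : Geodesic, side x y l ≤ 0 → ¬ (x ∈ l.points ∧ y ∈ l.points) → side x' y' l < 0 := by
  have hc := mink_le_neg_one hx hy
  have hyx := mink_comm y x
  set c := mink x y
  set m := 1 + 41 / 800 * (1 + c) with hm
  have hm0 : 0 < m := by rw [hm]; linarith
  -- The small factor `1/40` moves both ends outward while `cosh` of the distance grows from at most
  -- `31/20` to at most `5/3`.
  let u : Mink := (41 / 40 : ℝ) • x - (1 / 40 : ℝ) • y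
  let w : Mink := (41 / 40 : ℝ) • y - (1 / 40 : ℝ) • x
  have huu : mink u u = -m := by
    simp only [u, map_sub, map_smul, LinearMap.sub_apply, LinearMap.smul_apply, smul_eq_mul, hx.1,
      hy.1, hyx, hm]
    ring
  have hww : mink w w = -m := by
    simp only [w, map_sub, map_smul, LinearMap.sub_apply, LinearMap.smul_apply, smul_eq_mul, hx.1,
      hy.1, hyx, hm]
    ring
  have huw : mink u w = c + 41 / 800 * (1 + c) := by
    simp only [u, w, map_sub, map_smul, LinearMap.sub_apply, LinearMap.smul_apply, smul_eq_mul,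
      hx.1, hy.1, hyx]
    ring
  have hu0 : 0 < u.2 := snd_pos_of_causal (by rw [huu]; linarith) hx (by
    simp only [u, map_sub, map_smul, LinearMap.sub_apply, LinearMap.smul_apply, smul_eq_mul, hx.1,
      hyx]
    linarith)
  have hw0 : 0 < w.2 := snd_pos_of_causal (by rw [hww]; linarith) hy (by
    simp only [w, map_sub, map_smul, LinearMap.sub_apply, LinearMap.smul_apply, smul_eq_mul, hy.1]
    linarith)
  have hu := smul_mem_hyperbolicPlane (n := u) (by rw [huu]; linarith) hu0
  have hw := smul_mem_hyperbolicPlane (n := w) (by rw [hww]; linarith) hw0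
  rw [huu, neg_neg] at hu
  rw [hww, neg_neg] at hw
  have hs : 0 < Real.sqrt m := Real.sqrt_pos.2 hm0
  have hs2 : (Real.sqrt m)⁻¹ * (Real.sqrt m)⁻¹ = m⁻¹ := by
    rw [← mul_inv, Real.mul_self_sqrt hm0.le]
  refine ⟨_, hu, _, hw, ?_, fun l hl hlxy => ?_⟩
  · simp only [map_smul, LinearMap.smul_apply, smul_eq_mul]
    rw [← mul_assoc, hs2, huw, inv_mul_eq_div, le_div_iff₀ hm0, hm]
    linarith
  · obtain ⟨v, rfl⟩ := l.exists_mk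
    rw [side_mk] at hl ⊢
    have hpos : 0 < mink v x ^ 2 + mink v y ^ 2 := by
      by_contra! h
      have h1 : mink v x = 0 := by nlinarith [sq_nonneg (mink v x), sq_nonneg (mink v y)]
      have h2 : mink v y = 0 := by nlinarith [sq_nonneg (mink v x), sq_nonneg (mink v y)]
      exact hlxy ⟨⟨hx, h1⟩, ⟨hy, h2⟩⟩
    simp only [map_smul, smul_eq_mul, u, w, map_sub]
    have : (Real.sqrt m)⁻¹ * (41 / 40 * mink v x - 1 / 40 * mink v y)
        * ((Real.sqrt m)⁻¹ * (41 / 40 * mink v y - 1 / 40 * mink v x))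
        = m⁻¹ * ((41 / 40 * mink v x - 1 / 40 * mink v y)
          * (41 / 40 * mink v y - 1 / 40 * mink v x)) := by rw [← hs2]; ring
    rw [this]
    -- With `s = ⟨v, x⟩` and `t = ⟨v, y⟩`, the product is `(1682 s t - 41 (s² + t²)) / 1600`, where
    -- `s t ≤ 0` and `s`, `t` are not both zero.
    refine mul_neg_of_pos_of_neg (inv_pos.2 hm0) ?_
    nlinarith

theorem ConvexSpacelikeSurface.measure_side_neg_le (S : ConvexSpacelikeSurface)
    (hG : IsHomeomorph S.gaussMap) (h : S.invShapeNorm ≠ ∞) {μ : Measure Geodesic}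
    (hμ : IsDualLamination μ S.domainOfDependence) {x y : Mink} (hx : x ∈ hyperbolicPlane)
    (hy : y ∈ hyperbolicPlane) (hxy : -(5 / 3) ≤ mink x y) :
    μ {l | side x y l < 0} ≤ 4 * S.invShapeNorm := by
  obtain ⟨hL, x₀, hx₀, hatom, y₀, hsup⟩ := hμ
  have := hL.1
  have h1 := hL.sq_measure_le y₀ hx₀ hatom hx hy
  have h2 := S.mink_sub_self_le hG h hx hy hxy (hsup x hx) (hsup y hy)
  have h3 : μ.real {l | side x y l < 0} ≤ 4 * S.invShapeNorm.toReal :=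
    le_of_sq_le_sq (h1.trans h2) (by positivity)
  have hfin : μ {l | side x y l < 0} ≠ ∞ :=
    ((measure_mono fun l (hl : side x y l < 0) => hl.le).trans_lt
      (measure_side_nonpos_lt_top μ hx hy)).ne
  rw [← ENNReal.ofReal_toReal hfin, ← ENNReal.ofReal_toReal h,
    ← ENNReal.ofReal_ofNat, ← ENNReal.ofReal_mul (by norm_num)]
  exact ENNReal.ofReal_le_ofReal h3

/-- The mass estimate sees only strictly separating leaves, while a leaf through an end point may
carry an atom; prolonging the segment captures it. Leaves containing both end points would escape
this, hence `hl`. -/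
theorem ConvexSpacelikeSurface.measure_meeting_le (S : ConvexSpacelikeSurface)
    (hG : IsHomeomorph S.gaussMap) (h : S.invShapeNorm ≠ ∞) {μ : Measure Geodesic}
    (hμ : IsDualLamination μ S.domainOfDependence) {x y : Mink} (hx : x ∈ hyperbolicPlane)
    (hy : y ∈ hyperbolicPlane) (hxy : -Real.cosh 1 ≤ mink x y)
    (hl : ∀ l ∈ μ.support, ¬ (x ∈ l.points ∧ y ∈ l.points)) :
    μ (meeting (geodesicSegment x y)) ≤ 4 * S.invShapeNorm := by
  obtain ⟨x', hx', y', hy', hxy', H⟩ :=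
    exists_prolongation hx hy (by linarith [cosh_one_le])
  refine le_trans (measure_mono_ae ?_) (S.measure_side_neg_le hG h hμ hx' hy' hxy')
  filter_upwards [Measure.support_mem_ae (μ := μ)] with l hls hlm
  rw [meeting_geodesicSegment hx hy] at hlm
  exact H l hlm (hl l hls)

theorem neg_cosh_one_le_of_hypDist_le {x y : Mink} (hx : x ∈ hyperbolicPlane)
    (hy : y ∈ hyperbolicPlane) (h : hypDist x y ≤ 1) : -Real.cosh 1 ≤ mink x y := by
  have h1 : 1 ≤ -(mink x y) := by linarith [mink_le_neg_one hx hy]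
  have h2 := Real.cosh_arcosh h1
  have h3 : Real.cosh (Real.arcosh (-(mink x y))) ≤ Real.cosh 1 := by
    rw [Real.cosh_le_cosh, abs_of_nonneg (Real.arcosh_nonneg h1), abs_one]
    exact h
  linarith

theorem ConvexSpacelikeSurface.thurstonNorm_le (S : ConvexSpacelikeSurface)
    (hG : IsHomeomorph S.gaussMap) (h : S.invShapeNorm ≠ ∞) {μ : Measure Geodesic}
    (hμ : IsDualLamination μ S.domainOfDependence) : thurstonNorm μ ≤ 4 * S.invShapeNorm := by
  refine iSup₂_le fun x hx => iSup₂_le fun y hy => iSup₂_le fun hd ht => ?_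
  by_cases hxy : x = y
  · subst hxy
    by_cases hex : ∃ l ∈ μ.support, x ∈ l.points
    · obtain ⟨l, hl, hxl⟩ := hex
      obtain ⟨v, rfl⟩ := l.exists_mk
      have hv : mink (v : Mink) v = 1 := v.2
      have hvx : mink v x = 0 := hxl.2
      -- A one-point segment on a leaf violates the condition on end points, so it is enlarged to a
      -- unit segment orthogonal to that leaf. No leaf contains both ends: this one misses `y`, and
      -- any other is disjoint from it.
      set y := hypGeodesic x v 1 with hy'
      have hyH : y ∈ hyperbolicPlane := hypGeodesic_mem hx hvx hv 1
      have hxy : mink x y = -Real.cosh 1 := by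
        simp only [hy', hypGeodesic, map_add, map_smul, smul_eq_mul, hx.1]
        rw [mink_comm x, hvx]; ring
      have hvy : mink v y ≠ 0 := by
        simp only [hy', hypGeodesic, map_add, map_smul, smul_eq_mul, hvx, hv, mul_zero, mul_one,
          zero_add]
        exact (Real.sinh_pos_iff.2 one_pos).ne'
      refine le_trans (measure_mono ?_)
        (S.measure_meeting_le hG h hμ hx hyH hxy.ge fun l' hl' hc => ?_)
      · rw [meeting_geodesicSegment hx hx, meeting_geodesicSegment hx hyH]
        intro l' hl'
        obtain ⟨u, rfl⟩ := l'.exists_mk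
        have h0 : mink u x = 0 := mul_self_eq_zero.1 (le_antisymm hl' (mul_self_nonneg _))
        change mink u x * mink u y ≤ 0
        rw [h0, zero_mul]
      · have hne : Geodesic.mk v ≠ l' := by
          rintro rfl
          exact hvy hc.2.2
        exact (hμ.1.2.2 _ hl _ hl' hne).ne_of_mem hxl hc.1 rfl
    · push Not at hex
      refine S.measure_meeting_le hG h hμ hx hx ?_ fun l hl hc => hex l hl hc.1
      exact neg_cosh_one_le_of_hypDist_le hx hx hd
  · refine S.measure_meeting_le hG h hμ hx hy (neg_cosh_one_le_of_hypDist_le hx hy hd) ?_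
    intro l hl hc
    exact hxy (ht l hl ⟨hc.1, left_mem_geodesicSegment hx⟩ ⟨hc.2, right_mem_geodesicSegment hy⟩)

theorem four_le_two_mul_sqrt : (4 : ℝ) ≤ 2 * Real.sqrt (2 * (1 + Real.cosh 1)) := by
  have h : (2 : ℝ) ≤ Real.sqrt (2 * (1 + Real.cosh 1)) :=
    Real.le_sqrt_of_sq_le (by linarith [Real.one_le_cosh 1])
  linarith

theorem proposition4p5 (S : ConvexSpacelikeSurface) (hG : IsHomeomorph S.gaussMap)
    (μ : MeasureTheory.Measure Geodesic) (hμ : IsDualLamination μ S.domainOfDependence) :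
    thurstonNorm μ ≤
      ENNReal.ofReal (2 * Real.sqrt (2 * (1 + Real.cosh 1))) * S.invShapeNorm := by
  have hK := four_le_two_mul_sqrt
  by_cases h : S.invShapeNorm = ∞
  · rw [h, ENNReal.mul_top (ENNReal.ofReal_pos.2 (by linarith)).ne']
    exact le_top
  · refine (S.thurstonNorm_le hG h hμ).trans (mul_le_mul_left ?_ _)
    rw [← ENNReal.ofReal_ofNat]
    exact ENNReal.ofReal_le_ofReal hK
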